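/- All graphs are finite, simple and undirected. For a graph $G$ with $n$ vertices let $A(G)$ be its adjacency matrix, $D(G)$ the diagonal matrix of vertex degrees and $Q(G)=D(G)+A(G)$ its signless Laplacian; $\lambda_i(G)$ and $q_i(G)$ denote the $i$-th largest eigenvalue (with multiplicity) of $A(G)$ and of $Q(G)$, respectively. For disjoint $X,Y\subseteq V(G)$ let $e(X,Y)$ be the number of edges with one end in $X$ and the other in $Y$, and let $\kappa'(G)$ be the edge connectivity of $G$, i.e. the least number of edges whose deletion leaves a graph that is not connected. Let $\mathcal G_1$ be the class of graphs $G$ that have two disjoint non-empty proper vertex subsets $V_1,V_2$ with $V(G)\setminus(V_1\cup V_2)\neq\emptyset$ and $\kappa'(G)=e(V_i,V(G)\setminus V_i)$ for $i=1,2$. For positive integers $k,d$, the graph $G$ has property $P(k,d)$ if it contains $k$ pairwise edge-disjoint spanning trees and a further forest $F$, edge-disjoint from all of these trees, with $|E(F)|>\frac{d-1}{d}(n-1)$, such that if $F$ is not a spanning tree of $G$, then some component of $F$ has at least $d$ edges. **Corollary 3.2.** Let $k\ge 2$ be an integer and let $G\in\mathcal G_1$ be a graph with minimum degree $\delta\ge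 2k+2$. Then: (i) if $\displaystyle \lambda_3(G)<\delta-\frac{16\left(k+\frac{\delta-1}{\delta}\right)}{3(\delta+1)}$, then $G$ has property $P(k,\delta)$; (ii) if $\displaystyle q_3(G)<2\delta-\frac{16\left(k+\frac{\delta-1}{\delta}\right)}{3(\delta+1)}$, then $G$ has property $P(k,\delta)$. -/

import Mathlib

noncomputable section

namespace SpectralPacking

/-- The number `e(X, Y)` of edges of `G` with one end in `X` and the other end in `Y`. -/
def edgesBetween {V : Type*} (G : SimpleGraph V) (X Y : Set V) : ℕ :=
  {e : Sym2 V | e ∈ G.edgeSet ∧ ∃ x ∈ X, ∃ y ∈ Y, e = s(x, y)}.ncard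

/-- The edge connectivity `κ'(G)`: the least number of edges whose deletion from `G` leaves a
graph that is not connected (it is `0` for the one-vertex graph, where no such set exists). -/
def edgeConnectivity {V : Type*} (G : SimpleGraph V) : ℕ :=
  sInf {m : ℕ | ∃ X : Set (Sym2 V), X ⊆ G.edgeSet ∧ X.ncard = m ∧ ¬ (G.deleteEdges X).Connected}

/-- The class `𝒢_t`: there are `t + 1` non-empty, pairwise disjoint proper vertex subsets that do
not cover the vertex set and each of which has an edge boundary of size `κ'(G)`. -/
def InClassG {V : Type*} (t : ℕ) (G : SimpleGraph V) : Prop :=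
  ∃ W : Fin (t + 1) → Set V,
    (∀ i, (W i).Nonempty) ∧
    (∀ i, W i ≠ Set.univ) ∧
    (∀ i j, i ≠ j → Disjoint (W i) (W j)) ∧
    (Set.univ \ ⋃ i, W i).Nonempty ∧
    (∀ i, edgeConnectivity G = edgesBetween G (W i) (Set.univ \ W i))

/-- Property `P(k, d)`: there are `k` pairwise edge-disjoint spanning trees `T i` of `G` and a
further forest `F` in `G`, edge-disjoint from all of them, with more than
`((d - 1) / d) (|V(G)| - 1)` edges, such that `F` is a spanning tree or has a component with at
least `d` edges. Spanning subgraphs of `G` are graphs on the same vertex type lying below `G`;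
the forest `F` is taken on all of `V`, which adds only components without edges. -/
def HasPropertyP {V : Type*} [Fintype V] (k d : ℕ) (G : SimpleGraph V) : Prop :=
  ∃ (T : Fin k → SimpleGraph V) (F : SimpleGraph V),
    (∀ i, T i ≤ G ∧ (T i).IsTree) ∧
    (∀ i j, i ≠ j → Disjoint (T i).edgeSet (T j).edgeSet) ∧
    F ≤ G ∧ F.IsAcyclic ∧
    (∀ i, Disjoint F.edgeSet (T i).edgeSet) ∧
    (F.edgeSet.ncard : ℝ) > ((d : ℝ) - 1) / (d : ℝ) * ((Fintype.card V : ℝ) - 1) ∧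
    (¬ F.IsTree → ∃ C : F.ConnectedComponent, d ≤ C.toSimpleGraph.edgeSet.ncard)

/-- The `i`-th largest eigenvalue, `1 ≤ i ≤ n`, counted with multiplicity, of a real symmetric
matrix of order `n` (and `0` for `i` outside this range). Mathlib's `eigenvalues₀` lists the
eigenvalues in decreasing order, starting from index `0`. -/
def ithLargestEigenvalue {V : Type*} [Fintype V] [DecidableEq V] {M : Matrix V V ℝ}
    (hM : M.IsHermitian) (i : ℕ) : ℝ :=
  if h : 1 ≤ i ∧ i ≤ Fintype.card V then hM.eigenvalues₀ ⟨i - 1, by omega⟩ else 0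

variable {V : Type*} [Fintype V] [DecidableEq V] (G : SimpleGraph V) [DecidableRel G.Adj]

/-- The signless Laplacian matrix `Q(G) = D(G) + A(G)`. -/
def signlessLapMatrix : Matrix V V ℝ := G.degMatrix ℝ + G.adjMatrix ℝ

theorem isHermitian_signlessLapMatrix : (signlessLapMatrix G).IsHermitian :=
  (G.isHermitian_degMatrix ℝ).add (G.isHermitian_adjMatrix ℝ)

/-- `λ_i(G)`, the `i`-th largest eigenvalue of the adjacency matrix. -/
def adjEigenvalue (i : ℕ) : ℝ := ithLargestEigenvalue (G.isHermitian_adjMatrix ℝ) i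

/-- `q_i(G)`, the `i`-th largest eigenvalue of the signless Laplacian matrix. -/
def signlessLapEigenvalue (i : ℕ) : ℝ := ithLargestEigenvalue (isHermitian_signlessLapMatrix G) i

end SpectralPacking

end

/-! The conclusion holds in a stronger form: `G` has `k + 1` edge-disjoint spanning trees, and the
last one serves as `F`. Put `m = k + 1`, so that `2m ≤ δ`.

Spectral input: on functions constant on each of three disjoint sets and zero elsewhere, the
Laplacian form is at most twice the boundary sizes weighted by the squared values. Since `A = D - L`
and `Q = 2D - L`, three disjoint sets with at least `δ + 1` vertices and boundary at most `2m` would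
force the third eigenvalue up to `δ - 4m/(δ + 1)`, respectively `2δ - 4m/(δ + 1)`, against the
hypothesis. A non-empty set with boundary below `δ` has at least `δ + 1` vertices anyway, so no
three disjoint non-empty sets have boundary below `2m`.

Combinatorial input: suppose a partition into `c` parts has fewer than `m(c - 1)` crossing edges. At
most two parts have boundary below `2m`, and all boundaries are at least `κ'`, so counting gives `κ'
< m`. The two sets from the class `𝒢₁` and the complement of their union then have boundaries `κ'`,
`κ'` and at most `2κ' < 2m`, which is impossible. The Nash-Williams–Tutte theorem, proved here by
exchanges in a maximum family of forests, supplies the trees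
(`card_connectedComponent_le_of_inClassG`, `exists_disjoint_spanning_trees`). -/

noncomputable section

namespace SpectralPacking

open SimpleGraph

/-! ### Exchanges in families of edge-disjoint forests -/

section Packing
variable {V : Type*} {ι : Type*}

/-- Replacing an edge of a path of a forest by an edge joining the ends of the path leaves a
forest. -/
theorem isAcyclic_exchange {T : SimpleGraph V} (hT : T.IsAcyclic) {u v : V} {p : T.Walk u v}
    (hp : p.IsPath) {e : Sym2 V} (he : e ∈ p.edges) :
    (T.deleteEdges {e} ⊔ edge u v).IsAcyclic := by
  refine IsAcyclic.sup_edge_of_not_reachable ?_ (hT.anti (T.deleteEdges_le _))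
  rintro ⟨q⟩
  classical
  -- Paths in a forest are unique, so a path from `u` to `v` avoiding `e` would equal `p`, which
  -- contains `e`.
  have h := congrArg Subtype.val
    ((hT.subsingleton_path u v).elim ⟨p, hp⟩ ⟨q.toPath.1.mapLe (T.deleteEdges_le _), by simp⟩)
  simp only at h
  rw [h] at he
  simp only [Walk.edges_mapLe_eq_edges] at he
  simpa using q.toPath.1.edges_subset_edgeSet he

theorem reachable_of_adj_imp {H K : SimpleGraph V} (h : ∀ u v, H.Adj u v → K.Reachable u v)
    {u v : V} (huv : H.Reachable u v) : K.Reachable u v := by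
  obtain ⟨p⟩ := huv
  induction p with
  | nil => exact .rfl
  | cons ha _ ih => exact (h _ _ ha).trans ih

/-- A family of pairwise edge-disjoint forests in `G`. -/
structure IsForestFamily (G : SimpleGraph V) (F : ι → SimpleGraph V) : Prop where
  le : ∀ i, F i ≤ G
  acyclic : ∀ i, (F i).IsAcyclic
  disjoint : ∀ i j, i ≠ j → Disjoint (F i) (F j)

/-- The graph of the edges of `G` that lie in no member of the family. -/
def uncovered (G : SimpleGraph V) (F : ι → SimpleGraph V) : SimpleGraph V where
  Adj u v := G.Adj u v ∧ ∀ i, ¬ (F i).Adj u v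
  symm := ⟨fun _ _ h => ⟨h.1.symm, fun i hi => h.2 i hi.symm⟩⟩
  loopless := ⟨fun _ h => h.1.ne rfl⟩

/-- `F'` arises from `F` by adding an uncovered edge to one of the forests and removing an edge of
the cycle that it closes. -/
def Exchange [DecidableEq ι] (G : SimpleGraph V) (F F' : ι → SimpleGraph V) : Prop :=
  ∃ (i : ι) (u v : V) (p : (F i).Walk u v) (e : Sym2 V), (uncovered G F).Adj u v ∧ p.IsPath ∧
    e ∈ p.edges ∧ F' = Function.update F i ((F i).deleteEdges {e} ⊔ edge u v)

variable {G : SimpleGraph V} {F F' : ι → SimpleGraph V}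

theorem IsForestFamily.update_sup_edge [DecidableEq ι] (hF : IsForestFamily G F) {i : ι} {u v : V}
    (huv : (uncovered G F).Adj u v) {T : SimpleGraph V} (hT : T ≤ F i)
    (hac : (T ⊔ edge u v).IsAcyclic) :
    IsForestFamily G (Function.update F i (T ⊔ edge u v)) := by
  have hd : ∀ j, j ≠ i → Disjoint (T ⊔ edge u v) (F j) := fun j hj =>
    disjoint_sup_left.2 ⟨(hF.disjoint i j hj.symm).mono_left hT,
      ((disjoint_edge _).2 (huv.2 j)).symm⟩
  refine ⟨fun j => ?_, fun j => ?_, fun j l hjl => ?_⟩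
  · rcases eq_or_ne j i with rfl | hj
    · simpa using ⟨hT.trans (hF.le j), Or.inr huv.1⟩
    · simpa [hj] using hF.le j
  · rcases eq_or_ne j i with rfl | hj
    · simpa using hac
    · simpa [hj] using hF.acyclic j
  · rcases eq_or_ne j i with rfl | hj
    · simpa [hjl.symm] using hd l hjl.symm
    · rcases eq_or_ne l i with rfl | hl
      · simpa [hj] using (hd j hj).symm
      · simpa [hj, hl] using hF.disjoint j l hjl

/-- The total number of edges of a family of graphs. -/
def totalEdges [Fintype ι] (F : ι → SimpleGraph V) : ℕ := ∑ i, (F i).edgeSet.ncard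

variable [DecidableEq ι]

theorem Exchange.isForestFamily (hF : IsForestFamily G F) (h : Exchange G F F') :
    IsForestFamily G F' := by
  obtain ⟨i, u, v, p, e, huv, hp, he, rfl⟩ := h
  exact hF.update_sup_edge huv (deleteEdges_le _) (isAcyclic_exchange (hF.acyclic i) hp he)

theorem totalEdges_update [Fintype ι] (F : ι → SimpleGraph V) (i : ι) (T : SimpleGraph V) :
    totalEdges (Function.update F i T) + (F i).edgeSet.ncard =
      totalEdges F + T.edgeSet.ncard := by
  unfold totalEdges
  rw [← Finset.add_sum_erase _ _ (Finset.mem_univ i),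
    ← Finset.add_sum_erase Finset.univ (fun i => (F i).edgeSet.ncard) (Finset.mem_univ i)]
  have : ∀ j ∈ Finset.univ.erase i, (Function.update F i T j).edgeSet.ncard
      = (F j).edgeSet.ncard := fun j hj => by simp [(Finset.mem_erase.1 hj).1]
  rw [Finset.sum_congr rfl this]
  simp
  ring

theorem ncard_edgeSet_sup_edge [Finite V] {T : SimpleGraph V} {u v : V} (huv : u ≠ v)
    (h : ¬ T.Adj u v) : (T ⊔ edge u v).edgeSet.ncard = T.edgeSet.ncard + 1 := by
  rw [edgeSet_sup, edgeSet_edge_of_ne huv, Set.union_singleton,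
    Set.ncard_insert_of_notMem (by simpa using h) (Set.toFinite _)]

theorem Exchange.totalEdges_eq [Fintype ι] [Finite V] (h : Exchange G F F') :
    totalEdges F' = totalEdges F := by
  obtain ⟨i, u, v, p, e, huv, hp, he, rfl⟩ := h
  have h1 := totalEdges_update F i ((F i).deleteEdges {e} ⊔ edge u v)
  have he' : e ∈ (F i).edgeSet := p.edges_subset_edgeSet he
  have h2 : ((F i).deleteEdges {e}).edgeSet.ncard + 1 = (F i).edgeSet.ncard := by
    rw [edgeSet_deleteEdges]
    exact Set.ncard_sdiff_singleton_add_one he' (Set.toFinite _)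
  rw [ncard_edgeSet_sup_edge huv.1.ne (fun h => huv.2 i (deleteEdges_le _ h)), h2] at h1
  omega

/-- A family of edge-disjoint forests with the largest possible number of edges. -/
def IsMaxForestFamily [Fintype ι] (G : SimpleGraph V) (F : ι → SimpleGraph V) : Prop :=
  IsForestFamily G F ∧ ∀ F' : ι → SimpleGraph V, IsForestFamily G F' → totalEdges F' ≤ totalEdges F

variable [Fintype ι] [Finite V]

theorem Exchange.isMaxForestFamily (hF : IsMaxForestFamily G F) (h : Exchange G F F') :
    IsMaxForestFamily G F' :=
  ⟨h.isForestFamily hF.1, fun F'' h'' => h.totalEdges_eq.symm ▸ hF.2 F'' h''⟩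

theorem IsMaxForestFamily.of_reflTransGen (hF : IsMaxForestFamily G F)
    (h : Relation.ReflTransGen (Exchange G) F F') : IsMaxForestFamily G F' := by
  induction h with
  | refl => exact hF
  | tail _ hs ih => exact hs.isMaxForestFamily ih

/-- Otherwise the uncovered edge could be added to the `i`-th forest, giving a larger family. -/
theorem IsMaxForestFamily.reachable (hF : IsMaxForestFamily G F) {u v : V}
    (huv : (uncovered G F).Adj u v) (i : ι) : (F i).Reachable u v := by
  by_contra hn
  have h1 := hF.2 _ (hF.1.update_sup_edge huv le_rfl
    ((hF.1.acyclic i).sup_edge_of_not_reachable hn))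
  have h2 := totalEdges_update F i (F i ⊔ edge u v)
  rw [ncard_edgeSet_sup_edge huv.1.ne (huv.2 i)] at h2
  omega

/-- The graph of the edges that are uncovered by some family reachable from `F` by exchanges. -/
def exchangeGraph (G : SimpleGraph V) (F : ι → SimpleGraph V) : SimpleGraph V where
  Adj u v := ∃ F', Relation.ReflTransGen (Exchange G) F F' ∧ (uncovered G F').Adj u v
  symm := ⟨fun _ _ ⟨F', h, h'⟩ => ⟨F', h, h'.symm⟩⟩
  loopless := ⟨fun _ ⟨_, _, h'⟩ => h'.ne rfl⟩

/-- Each edge of the path in `F' i` that joins `u` to `v` can be exchanged for `uv`. It is then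
uncovered, hence an edge of the exchange graph. -/
theorem IsMaxForestFamily.reachable_inf (hF : IsMaxForestFamily G F)
    (h : Relation.ReflTransGen (Exchange G) F F') {u v : V} (huv : (uncovered G F').Adj u v)
    (i : ι) : (F' i ⊓ exchangeGraph G F).Reachable u v := by
  have hF' := hF.of_reflTransGen h
  obtain ⟨p, hp⟩ := (hF'.reachable huv i).exists_isPath
  refine ⟨p.transfer _ fun e he => ?_⟩
  induction e with | h x y => ?_
  have hxy : (F' i).Adj x y := p.adj_of_mem_edges he
  refine ⟨hxy, _, h.tail ⟨i, u, v, p, _, huv, hp, he, rfl⟩, hF'.1.le i hxy, fun j => ?_⟩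
  rcases eq_or_ne j i with rfl | hj
  · simp only [Function.update_self, sup_adj, deleteEdges_adj, Set.mem_singleton_iff,
      not_true_eq_false, and_false, false_or, adj_edge, not_and]
    intro heq
    have h2 := huv.2 j
    rw [← mem_edgeSet, heq] at h2
    exact absurd hxy h2
  · rw [Function.update_of_ne hj]
    intro hadj
    exact (SimpleGraph.disjoint_left.1 (hF'.1.disjoint j i hj)) x y hadj hxy

/-- Undoing one exchange loses only the added edge, and the path that it closed to a cycle replaces
it inside the exchange graph. -/
theorem IsMaxForestFamily.reachable_inf_of_reflTransGen (hF : IsMaxForestFamily G F)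
    (h : Relation.ReflTransGen (Exchange G) F F') (j : ι) {x y : V}
    (hxy : (F' j ⊓ exchangeGraph G F).Reachable x y) :
    (F j ⊓ exchangeGraph G F).Reachable x y := by
  induction h with
  | refl => exact hxy
  | @tail F₁ F₂ h₁ hs ih =>
    refine ih (reachable_of_adj_imp (fun a b hab => ?_) hxy)
    obtain ⟨i, u, v, p, e, huv, hp, he, rfl⟩ := hs
    obtain ⟨hab, hS⟩ := hab
    rcases eq_or_ne j i with rfl | hj
    · rw [Function.update_self] at hab
      rcases hab with hab | hab
      · exact Adj.reachable ⟨deleteEdges_le _ hab, hS⟩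
      · have h3 := hF.reachable_inf h₁ huv j
        rcases (edge_adj _ _ _ _).1 hab with ⟨⟨rfl, rfl⟩ | ⟨rfl, rfl⟩, -⟩
        · exact h3
        · exact h3.symm
    · rw [Function.update_of_ne hj] at hab
      exact Adj.reachable ⟨hab, hS⟩

/-- The crux of the packing theorem: every forest of a maximum family spans each component of the
exchange graph using edges of that graph only. -/
theorem IsMaxForestFamily.reachable_inf_iff (hF : IsMaxForestFamily G F) (j : ι) {x y : V} :
    (F j ⊓ exchangeGraph G F).Reachable x y ↔ (exchangeGraph G F).Reachable x y := by
  refine ⟨fun h => h.mono inf_le_right, fun h => reachable_of_adj_imp ?_ h⟩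
  rintro u v ⟨F', h', huv⟩
  exact hF.reachable_inf_of_reflTransGen h' j (hF.reachable_inf h' huv j)

end Packing

/-! ### Counting edges of forests; the Nash-Williams–Tutte theorem -/

section Counting
variable {V : Type*} [Fintype V]

theorem sum_degree_connectedComponent {H : SimpleGraph V} [DecidableRel H.Adj]
    (hH : H.IsAcyclic) (C : H.ConnectedComponent) [Fintype C] :
    ∑ v : C, H.degree v + 2 = 2 * Fintype.card C := by
  classical
  have h1 := (hH.isTree_connectedComponent C).card_edgeFinset
  have h2 := C.toSimpleGraph.sum_degrees_eq_twice_card_edges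
  have h3 : ∀ v : C, C.toSimpleGraph.degree v = H.degree v := fun v => by
    rw [← card_neighborFinset_eq_degree, ← card_neighborFinset_eq_degree]
    refine Finset.card_bij (fun w _ => w.1) ?_ (fun _ _ _ _ h => Subtype.ext h) ?_
    · intro w hw
      rw [mem_neighborFinset] at hw ⊢
      exact hw
    · intro w hw
      rw [mem_neighborFinset] at hw
      exact ⟨⟨w, (C.mem_supp_congr_adj hw).1 v.2⟩, by rw [mem_neighborFinset]; exact hw, rfl⟩
  rw [Finset.sum_congr rfl fun v _ => h3 v] at h2
  omega

theorem IsAcyclic.ncard_edgeSet_add_card_connectedComponent {H : SimpleGraph V}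
    (hH : H.IsAcyclic) :
    H.edgeSet.ncard + Nat.card H.ConnectedComponent = Fintype.card V := by
  classical
  have h1 := H.sum_degrees_eq_twice_card_edges
  have h2 : H.edgeSet.ncard = H.edgeFinset.card := by
    rw [← coe_edgeFinset, Set.ncard_coe_finset]
  have h3 : ∀ f : V → ℕ, ∑ v, f v = ∑ C : H.ConnectedComponent, ∑ v : C, f v := fun f => by
    rw [← Finset.sum_fiberwise Finset.univ H.connectedComponentMk f]
    refine Finset.sum_congr rfl fun C _ => Finset.sum_subtype _ (fun x => ?_) _
    rw [Finset.mem_filter_univ]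
    exact ConnectedComponent.mem_supp_iff C x
  have h4 : ∑ C : H.ConnectedComponent, (∑ v : C, H.degree v + 2)
      = ∑ C : H.ConnectedComponent, 2 * Fintype.card C :=
    Finset.sum_congr rfl fun C _ => sum_degree_connectedComponent hH C
  have h5 := h3 fun _ => 1
  simp only [Finset.sum_const, Finset.card_univ, smul_eq_mul, mul_one] at h5
  rw [Finset.sum_add_distrib, ← h3 fun v => H.degree v, ← Finset.mul_sum, ← h5] at h4
  simp only [Finset.sum_const, Finset.card_univ, smul_eq_mul] at h4
  rw [Nat.card_eq_fintype_card]
  omega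

omit [Fintype V] in
theorem card_connectedComponent_congr {H K : SimpleGraph V}
    (h : ∀ x y, H.Reachable x y ↔ K.Reachable x y) :
    Nat.card H.ConnectedComponent = Nat.card K.ConnectedComponent :=
  Nat.card_congr (Quot.congr (Equiv.refl V) h)

/-- The graph of the edges of `G` that join different components of `H`. -/
def crossing {V : Type*} (G H : SimpleGraph V) : SimpleGraph V where
  Adj u v := G.Adj u v ∧ ¬ H.Reachable u v
  symm := ⟨fun _ _ h => ⟨h.1.symm, fun h' => h.2 h'.symm⟩⟩
  loopless := ⟨fun _ h => h.1.ne rfl⟩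

/-- The **Nash-Williams–Tutte theorem**, sufficiency: if for every graph `H` at least
`k * (c - 1)` edges of `G` join different ones of the `c` components of `H`, then `G` has `k`
edge-disjoint spanning trees. -/
theorem exists_disjoint_spanning_trees [Nonempty V] (G : SimpleGraph V) (k : ℕ)
    (h : ∀ H : SimpleGraph V,
      k * Nat.card H.ConnectedComponent ≤ (crossing G H).edgeSet.ncard + k) :
    ∃ T : Fin k → SimpleGraph V, (∀ i, T i ≤ G ∧ (T i).IsTree) ∧
      ∀ i j, i ≠ j → Disjoint (T i) (T j) := by
  classical
  obtain ⟨F, hF⟩ : ∃ F : Fin k → SimpleGraph V, IsMaxForestFamily G F := by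
    have : Nonempty {F : Fin k → SimpleGraph V // IsForestFamily G F} :=
      ⟨fun _ => ⊥, fun _ => bot_le, fun _ => isAcyclic_bot, fun _ _ _ => disjoint_bot_left⟩
    obtain ⟨F, hF⟩ := Finite.exists_max
      fun F : {F : Fin k → SimpleGraph V // IsForestFamily G F} => totalEdges F.1
    exact ⟨F.1, F.2, fun F' h' => hF ⟨F', h'⟩⟩
  set S := exchangeGraph G F with hS
  -- An edge between components of `S` is not in `S`. With no exchange made at all, this says that
  -- some `F i` covers it.
  have hcr : (crossing G S).edgeSet.ncard ≤ ∑ i, (F i \ S).edgeSet.ncard := by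
    calc (crossing G S).edgeSet.ncard ≤ (⋃ i ∈ Finset.univ, (F i \ S).edgeSet).ncard := by
          refine Set.ncard_le_ncard ?_ (Set.toFinite _)
          intro e
          induction e with | h u v => ?_
          rintro ⟨h1, h2⟩
          have h3 : ¬ S.Adj u v := fun h3 => h2 h3.reachable
          by_contra h4
          refine h3 ⟨F, .refl, h1, fun i hi => h4 ?_⟩
          simp only [Set.mem_iUnion]
          exact ⟨i, Finset.mem_univ i, hi, h3⟩
      _ ≤ ∑ i, (F i \ S).edgeSet.ncard := Finset.set_ncard_biUnion_le _ _
  -- The forests `F i` and `F i ⊓ S` have `n` minus their number of components as edge counts, and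
  -- the latter has the components of `S`.
  have hcount : ∀ i, (F i \ S).edgeSet.ncard + Nat.card (F i).ConnectedComponent
      = Nat.card S.ConnectedComponent := by
    intro i
    have h1 := IsAcyclic.ncard_edgeSet_add_card_connectedComponent (hF.1.acyclic i)
    have h2 := IsAcyclic.ncard_edgeSet_add_card_connectedComponent
      ((hF.1.acyclic i).anti (inf_le_left : F i ⊓ S ≤ F i))
    rw [card_connectedComponent_congr fun x y => hF.reachable_inf_iff i] at h2
    rw [← hS] at h2
    have h3 := Set.ncard_inter_add_ncard_sdiff_eq_ncard (F i).edgeSet S.edgeSet (Set.toFinite _)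
    rw [← edgeSet_inf, ← edgeSet_sdiff] at h3
    omega
  have hpos : ∀ i, 1 ≤ Nat.card (F i).ConnectedComponent := fun i => Nat.card_pos
  have hsum : ∑ i, Nat.card (F i).ConnectedComponent ≤ ∑ _i : Fin k, 1 := by
    have h1 : ∑ i, ((F i \ S).edgeSet.ncard + Nat.card (F i).ConnectedComponent)
        = k * Nat.card S.ConnectedComponent := by
      rw [Finset.sum_congr rfl fun i _ => hcount i]
      simp
    rw [Finset.sum_add_distrib] at h1
    have h2 := h S
    simp only [Finset.sum_const, Finset.card_univ, Fintype.card_fin, smul_eq_mul, mul_one]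
    omega
  have hone : ∀ i, Nat.card (F i).ConnectedComponent = 1 := fun i =>
    ((Finset.sum_eq_sum_iff_of_le fun i _ => hpos i).1
      (le_antisymm (Finset.sum_le_sum fun i _ => hpos i) hsum) i (Finset.mem_univ i)).symm
  refine ⟨F, fun i => ⟨hF.1.le i, ⟨?_⟩, hF.1.acyclic i⟩, hF.1.disjoint⟩
  have := (Nat.card_eq_one_iff_unique.1 (hone i)).1
  exact fun x y => ConnectedComponent.exact (Subsingleton.elim _ _)

end Counting

/-! ### Eigenvalue bounds from disjoint sets with small boundary -/

section Spectral
open Matrix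
variable {V : Type*} [Fintype V] [DecidableEq V]

/-- One half of the **Courant–Fischer** theorem: if the quadratic form of `M` is at least `μ` times
the squared norm on a space of dimension `j + 1`, then the `(j + 1)`-st eigenvalue is at least `μ`. -/
theorem le_ithLargestEigenvalue {M : Matrix V V ℝ} (hM : M.IsHermitian) (j : ℕ)
    (L : (Fin (j + 1) → ℝ) →ₗ[ℝ] (V → ℝ)) (hL : Function.Injective L) (μ : ℝ)
    (h : ∀ c, μ * (L c ⬝ᵥ L c) ≤ L c ⬝ᵥ M *ᵥ L c) :
    μ ≤ ithLargestEigenvalue hM (j + 1) := by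
  have hj : j + 1 ≤ Fintype.card V := by
    simpa using LinearMap.finrank_le_finrank_of_injective hL
  rw [ithLargestEigenvalue, dif_pos ⟨by omega, hj⟩]
  have hT := isSymmetric_toEuclideanLin_iff.mpr hM
  set b := hT.eigenvectorBasis finrank_euclideanSpace with hb
  -- A non-zero kernel vector of `Φ` is mapped by `L` to a vector orthogonal to the first `j`
  -- eigenvectors, whose Rayleigh quotient is at most the next eigenvalue.
  let Φ : (Fin (j + 1) → ℝ) →ₗ[ℝ] (Fin j → ℝ) :=
    { toFun := fun c i => b.repr (WithLp.toLp 2 (L c)) ⟨i, by omega⟩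
      map_add' := fun c d => by ext i; simp
      map_smul' := fun r c => by ext i; simp }
  obtain ⟨c, hc, hc0⟩ := (Submodule.ne_bot_iff _).1
    (LinearMap.ker_ne_bot_of_finrank_lt (f := Φ) (by simp))
  have hΦ : ∀ i : Fin (Fintype.card V), (i : ℕ) < j → b.repr (WithLp.toLp 2 (L c)) i = 0 :=
    fun i hi => congrFun (LinearMap.mem_ker.1 hc) ⟨i, hi⟩
  set x : EuclideanSpace ℝ V := WithLp.toLp 2 (L c) with hx
  have hx0 : x ≠ 0 := fun h0 => hc0 (hL (by
    rw [map_zero]; exact congrArg WithLp.ofLp h0))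
  have h1 : L c ⬝ᵥ L c = ∑ i, b.repr x i ^ 2 := by
    have := b.sum_sq_inner_right x
    simp only [b.repr_apply_apply, this, EuclideanSpace.norm_sq_eq, Real.norm_eq_abs, sq_abs]
    simp only [hx, dotProduct, sq]
  have h2 : L c ⬝ᵥ M *ᵥ L c = ∑ i, hM.eigenvalues₀ i * b.repr x i ^ 2 := by
    have h3 : inner ℝ x (toEuclideanLin M x) = L c ⬝ᵥ M *ᵥ L c := by
      rw [EuclideanSpace.inner_eq_star_dotProduct, dotProduct_comm]
      simp [hx]
    rw [← h3, ← b.repr.inner_map_map, PiLp.inner_apply]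
    refine Finset.sum_congr rfl fun i _ => ?_
    rw [hT.eigenvectorBasis_apply_self_apply]
    simp only [RCLike.inner_apply, conj_trivial, RCLike.ofReal_real_eq_id, id_eq,
      IsHermitian.eigenvalues₀]
    ring
  have h4 := h c
  have h5 : 0 < ∑ i, b.repr x i ^ 2 := by
    have := b.sum_sq_inner_right x
    simp only [b.repr_apply_apply, this]
    positivity
  have h6 : ∑ i, hM.eigenvalues₀ i * b.repr x i ^ 2
      ≤ hM.eigenvalues₀ ⟨j + 1 - 1, by omega⟩ * ∑ i, b.repr x i ^ 2 := by
    rw [Finset.mul_sum]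
    refine Finset.sum_le_sum fun i _ => ?_
    rcases lt_or_ge (i : ℕ) j with hi | hi
    · simp [hΦ i hi]
    · exact mul_le_mul_of_nonneg_right (hM.eigenvalues₀_antitone (by
        rw [Fin.le_def]; simpa using hi)) (sq_nonneg _)
  rw [h1, h2] at h4
  exact le_of_mul_le_mul_right (h4.trans h6) h5

variable (G : SimpleGraph V) [DecidableRel G.Adj]

/-- The number of edges of `G` that leave `X`, counted as ordered pairs. -/
def boundaryCard (X : Finset V) : ℕ := ∑ u ∈ X, (Finset.univ.filter fun v => G.Adj u v ∧ v ∉ X).card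

/-- The linear combination of the indicator functions of the sets `X i` with coefficients `c i`. -/
def stepFunction {ι : Type*} [Fintype ι] (X : ι → Finset V) : (ι → ℝ) →ₗ[ℝ] (V → ℝ) where
  toFun c v := ∑ i, if v ∈ X i then c i else 0
  map_add' c d := by
    ext v
    simp only [Pi.add_apply, ← Finset.sum_add_distrib]
    exact Finset.sum_congr rfl fun i _ => by split_ifs <;> simp
  map_smul' r c := by
    ext v
    simp [Finset.mul_sum]

variable {G} {ι : Type*} [Fintype ι] {X : ι → Finset V}

omit [Fintype V] in
theorem sum_ite_mem_of_mem (hX : ∀ i j, i ≠ j → Disjoint (X i) (X j)) {v : V} {i : ι}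
    (hv : v ∈ X i) (c : ι → ℝ) : (∑ j, if v ∈ X j then c j else 0) = c i := by
  classical
  rw [Finset.sum_eq_single i]
  · simp [hv]
  · intro j _ hj
    rw [if_neg (Finset.disjoint_left.1 (hX i j hj.symm) hv)]
  · simp

omit [Fintype V] in
theorem stepFunction_of_mem (hX : ∀ i j, i ≠ j → Disjoint (X i) (X j)) {v : V} {i : ι}
    (hv : v ∈ X i) (c : ι → ℝ) : stepFunction X c v = c i :=
  sum_ite_mem_of_mem hX hv c

omit [Fintype V] in
theorem stepFunction_of_notMem {v : V} (hv : ∀ i, v ∉ X i) (c : ι → ℝ) :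
    stepFunction X c v = 0 := by
  simp [stepFunction, hv]

theorem stepFunction_dotProduct_self (hX : ∀ i j, i ≠ j → Disjoint (X i) (X j)) (c : ι → ℝ) :
    stepFunction X c ⬝ᵥ stepFunction X c = ∑ i, (X i).card * c i ^ 2 := by
  have h1 : ∀ v, stepFunction X c v * stepFunction X c v
      = ∑ i, if v ∈ X i then c i ^ 2 else 0 := by
    intro v
    by_cases hv : ∃ i, v ∈ X i
    · obtain ⟨i, hi⟩ := hv
      rw [stepFunction_of_mem hX hi, sum_ite_mem_of_mem hX hi fun i => c i ^ 2, sq]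
    · push Not at hv
      simp [stepFunction_of_notMem hv, hv]
  simp only [dotProduct, h1]
  rw [Finset.sum_comm]
  simp

theorem stepFunction_dotProduct_lapMatrix_le (hX : ∀ i j, i ≠ j → Disjoint (X i) (X j))
    (c : ι → ℝ) : stepFunction X c ⬝ᵥ G.lapMatrix ℝ *ᵥ stepFunction X c
      ≤ 2 * ∑ i, boundaryCard G (X i) * c i ^ 2 := by
  set f := stepFunction X c with hf
  -- An edge inside one `X i` contributes nothing; for any other, `(a - b)² ≤ 2a² + 2b²` charges
  -- each end to the boundary of its own set.
  let g : V → V → ℝ := fun u v => ∑ i, if u ∈ X i ∧ v ∉ X i then c i ^ 2 else 0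
  have hg0 : ∀ u v, 0 ≤ g u v := fun u v =>
    Finset.sum_nonneg fun i _ => by split_ifs <;> positivity
  have hg : ∀ u v i, u ∈ X i → v ∉ X i → f u ^ 2 ≤ g u v := by
    intro u v i hu hv
    rw [hf, stepFunction_of_mem hX hu]
    calc c i ^ 2 = if u ∈ X i ∧ v ∉ X i then c i ^ 2 else 0 := by simp [hu, hv]
      _ ≤ g u v := Finset.single_le_sum (f := fun i => if u ∈ X i ∧ v ∉ X i then c i ^ 2 else 0)
        (fun i _ => by split_ifs <;> positivity) (Finset.mem_univ i)
  have hz : ∀ u, (∃ i, u ∈ X i) ∨ f u = 0 := fun u => by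
    by_cases h : ∃ i, u ∈ X i
    · exact Or.inl h
    · push Not at h
      exact Or.inr (stepFunction_of_notMem h c)
  have hpt : ∀ u v, (f u - f v) ^ 2 ≤ 2 * g u v + 2 * g v u := by
    intro u v
    by_cases hsame : ∃ i, u ∈ X i ∧ v ∈ X i
    · obtain ⟨i, hu, hv⟩ := hsame
      have : f u - f v = 0 := by
        rw [hf, stepFunction_of_mem hX hu, stepFunction_of_mem hX hv, sub_self]
      rw [this]
      linarith [hg0 u v, hg0 v u]
    · push Not at hsame
      have h1 : f u ^ 2 ≤ g u v := by
        rcases hz u with ⟨i, hi⟩ | h0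
        · exact hg u v i hi (hsame i hi)
        · simpa [h0] using hg0 u v
      have h2 : f v ^ 2 ≤ g v u := by
        rcases hz v with ⟨i, hi⟩ | h0
        · exact hg v u i hi fun hu => hsame i hu hi
        · simpa [h0] using hg0 v u
      nlinarith [sq_nonneg (f u + f v)]
  have hsum : (∑ u, ∑ v, if G.Adj u v then g u v else 0)
      = ∑ i, boundaryCard G (X i) * c i ^ 2 := by
    have h1 : ∀ u v, (if G.Adj u v then g u v else 0)
        = ∑ i, if u ∈ X i then (if G.Adj u v ∧ v ∉ X i then c i ^ 2 else 0) else 0 := by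
      intro u v
      by_cases h : G.Adj u v
      · simp only [h, if_true, true_and, g, ite_and]
      · simp [h]
    simp only [h1]
    calc _ = ∑ u, ∑ i, ∑ v, (if u ∈ X i then
            (if G.Adj u v ∧ v ∉ X i then c i ^ 2 else 0) else 0) :=
          Finset.sum_congr rfl fun u _ => Finset.sum_comm
      _ = ∑ i, ∑ u, ∑ v, (if u ∈ X i then
            (if G.Adj u v ∧ v ∉ X i then c i ^ 2 else 0) else 0) := Finset.sum_comm
      _ = _ := by
        refine Finset.sum_congr rfl fun i _ => ?_
        rw [boundaryCard, Nat.cast_sum, Finset.sum_mul]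
        rw [← Finset.sum_filter_add_sum_filter_not Finset.univ (fun u => u ∈ X i)]
        have : ∑ u with u ∉ X i, ∑ v, (if u ∈ X i then
            (if G.Adj u v ∧ v ∉ X i then c i ^ 2 else 0) else 0) = 0 :=
          Finset.sum_eq_zero fun u hu => by simp [(Finset.mem_filter.1 hu).2]
        rw [this, add_zero]
        refine Finset.sum_congr (by ext; simp) fun u hu => ?_
        simp only [hu, if_true]
        rw [← Finset.sum_filter, Finset.sum_const, nsmul_eq_mul]
  have hswap : (∑ u, ∑ v, if G.Adj u v then g v u else 0)
      = ∑ u, ∑ v, if G.Adj u v then g u v else 0 := by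
    rw [Finset.sum_comm]
    simp only [G.adj_comm]
  have hlap := G.lapMatrix_toLinearMap₂' ℝ f
  rw [toLinearMap₂'_apply'] at hlap
  rw [hlap]
  have : (∑ u, ∑ v, if G.Adj u v then (f u - f v) ^ 2 else 0)
      ≤ ∑ u, ∑ v, (2 * (if G.Adj u v then g u v else 0) + 2 * if G.Adj u v then g v u else 0) := by
    refine Finset.sum_le_sum fun u _ => Finset.sum_le_sum fun v _ => ?_
    split_ifs
    · exact hpt u v
    · simp
  simp only [Finset.sum_add_distrib, ← Finset.mul_sum] at this
  rw [hswap, hsum] at this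
  linarith

/-- Treats both matrices at once: `a = 1` gives the adjacency matrix, `a = 2` the signless
Laplacian. -/
theorem le_ithLargestEigenvalue_of_boundaryCard_le {M : Matrix V V ℝ} (hM : M.IsHermitian)
    {a : ℝ} (ha : 0 ≤ a)
    (hMG : ∀ x, x ⬝ᵥ M *ᵥ x = a * (x ⬝ᵥ G.degMatrix ℝ *ᵥ x) - x ⬝ᵥ G.lapMatrix ℝ *ᵥ x)
    {j : ℕ} {X : Fin (j + 1) → Finset V} (hX : ∀ i j, i ≠ j → Disjoint (X i) (X j)) {B s : ℕ}
    (hB : ∀ i, boundaryCard G (X i) ≤ B) (hs : 0 < s) (hsX : ∀ i, s ≤ (X i).card) :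
    a * G.minDegree - 2 * B / s ≤ ithLargestEigenvalue hM (j + 1) := by
  refine le_ithLargestEigenvalue hM j (stepFunction X) ?_ _ fun c => ?_
  · intro c d hcd
    ext i
    obtain ⟨v, hv⟩ := Finset.card_pos.1 (hs.trans_le (hsX i))
    rw [← stepFunction_of_mem hX hv c, hcd, stepFunction_of_mem hX hv d]
  · have hdeg : (G.minDegree : ℝ) * (stepFunction X c ⬝ᵥ stepFunction X c)
        ≤ stepFunction X c ⬝ᵥ G.degMatrix ℝ *ᵥ stepFunction X c := by
      rw [dotProduct_mulVec_degMatrix, dotProduct, Finset.mul_sum]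
      refine Finset.sum_le_sum fun v _ => ?_
      rw [mul_assoc]
      exact mul_le_mul_of_nonneg_right (by exact_mod_cast G.minDegree_le_degree v)
        (mul_self_nonneg _)
    have hlap := stepFunction_dotProduct_lapMatrix_le (G := G) hX c
    have hs' : (0 : ℝ) < s := by exact_mod_cast hs
    have h1 : ∑ i, (boundaryCard G (X i) : ℝ) * c i ^ 2 ≤
        B / s * (stepFunction X c ⬝ᵥ stepFunction X c) := by
      rw [stepFunction_dotProduct_self hX, Finset.mul_sum]
      refine Finset.sum_le_sum fun i _ => ?_
      rw [← mul_assoc]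
      refine mul_le_mul_of_nonneg_right ?_ (sq_nonneg _)
      calc (boundaryCard G (X i) : ℝ) ≤ B := by exact_mod_cast hB i
        _ = B / s * s := by field_simp
        _ ≤ _ := by gcongr; exact hsX i
    rw [hMG, sub_mul, mul_assoc]
    have h2 := mul_le_mul_of_nonneg_left hdeg ha
    have h3 : 2 * (B : ℝ) / s * (stepFunction X c ⬝ᵥ stepFunction X c)
        = 2 * (B / s * (stepFunction X c ⬝ᵥ stepFunction X c)) := by ring
    rw [h3]
    linarith

theorem le_adjEigenvalue {j : ℕ} {X : Fin (j + 1) → Finset V}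
    (hX : ∀ i j, i ≠ j → Disjoint (X i) (X j)) {B s : ℕ}
    (hB : ∀ i, boundaryCard G (X i) ≤ B) (hs : 0 < s) (hsX : ∀ i, s ≤ (X i).card) :
    G.minDegree - 2 * B / s ≤ adjEigenvalue G (j + 1) := by
  have := le_ithLargestEigenvalue_of_boundaryCard_le (G.isHermitian_adjMatrix ℝ) zero_le_one
    (fun x => by simp [lapMatrix, sub_mulVec, dotProduct_sub]) hX hB hs hsX
  rwa [one_mul] at this

theorem le_signlessLapEigenvalue {j : ℕ} {X : Fin (j + 1) → Finset V}
    (hX : ∀ i j, i ≠ j → Disjoint (X i) (X j)) {B s : ℕ}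
    (hB : ∀ i, boundaryCard G (X i) ≤ B) (hs : 0 < s) (hsX : ∀ i, s ≤ (X i).card) :
    2 * G.minDegree - 2 * B / s ≤ signlessLapEigenvalue G (j + 1) :=
  le_ithLargestEigenvalue_of_boundaryCard_le (isHermitian_signlessLapMatrix G) zero_le_two
    (fun x => by
      simp only [signlessLapMatrix, lapMatrix, add_mulVec, dotProduct_add, sub_mulVec,
        dotProduct_sub]
      ring) hX hB hs hsX

end Spectral

/-! ### Edge boundaries, edge connectivity and partitions -/

section Boundary
variable {V : Type*} [Fintype V] [DecidableEq V] {G : SimpleGraph V} [DecidableRel G.Adj]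

/-- Each vertex of `X` has at least `δ + 1 - |X|` neighbours outside, and `|X| (δ + 1 - |X|) ≥ δ`
when `1 ≤ |X| ≤ δ`. -/
theorem minDegree_lt_card_of_boundaryCard_lt {X : Finset V} (hX : X.Nonempty)
    (h : boundaryCard G X < G.minDegree) : G.minDegree + 1 ≤ X.card := by
  by_contra! hc
  have h1 : ∀ u ∈ X, G.minDegree + 1 - X.card
      ≤ (Finset.univ.filter fun v => G.Adj u v ∧ v ∉ X).card := by
    intro u hu
    have h2 : G.neighborFinset u ⊆ X.erase u ∪ Finset.univ.filter fun v => G.Adj u v ∧ v ∉ X := by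
      intro v hv
      rw [mem_neighborFinset] at hv
      by_cases hvX : v ∈ X
      · exact Finset.mem_union_left _ (Finset.mem_erase.2 ⟨hv.ne', hvX⟩)
      · exact Finset.mem_union_right _ (by simp [hv, hvX])
    have h3 := (Finset.card_le_card h2).trans (Finset.card_union_le _ _)
    rw [card_neighborFinset_eq_degree, Finset.card_erase_of_mem hu] at h3
    have h4 := G.minDegree_le_degree u
    have h5 := hX.card_pos
    omega
  have h2 := Finset.card_nsmul_le_sum X _ _ h1
  have h3 : X.card • (G.minDegree + 1 - X.card) ≤ boundaryCard G X := h2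
  obtain ⟨a, ha⟩ := Nat.exists_eq_add_of_le (Nat.lt_succ_iff.1 hc)
  obtain ⟨b, hb⟩ := Nat.exists_eq_add_of_le hX.card_pos
  rw [smul_eq_mul, ha, show X.card + a + 1 - X.card = a + 1 by omega] at h3
  rw [hb] at h3 ha
  nlinarith [Nat.zero_le (b * a)]

theorem boundaryCard_eq_sum (X : Finset V) :
    boundaryCard G X = ∑ u, ∑ v, if u ∈ X ∧ v ∉ X ∧ G.Adj u v then 1 else 0 := by
  rw [boundaryCard, ← Finset.sum_filter_add_sum_filter_not Finset.univ (· ∈ X),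
    Finset.sum_eq_zero (s := Finset.univ.filter fun u => u ∉ X), add_zero]
  · refine Finset.sum_congr (by ext; simp) fun u hu => ?_
    rw [Finset.card_filter]
    exact Finset.sum_congr rfl fun v _ => by
      simp [(Finset.mem_filter.1 hu).2, and_comm]
  · intro u hu
    simp [(Finset.mem_filter.1 hu).2]

theorem boundaryCard_compl (X : Finset V) : boundaryCard G Xᶜ = boundaryCard G X := by
  rw [boundaryCard_eq_sum, boundaryCard_eq_sum, Finset.sum_comm]
  refine Finset.sum_congr rfl fun u _ => Finset.sum_congr rfl fun v _ => if_congr ?_ rfl rfl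
  rw [Finset.mem_compl, Finset.mem_compl, not_not, G.adj_comm]
  tauto

theorem boundaryCard_union_le (X Y : Finset V) :
    boundaryCard G (X ∪ Y) ≤ boundaryCard G X + boundaryCard G Y := by
  simp only [boundaryCard_eq_sum, ← Finset.sum_add_distrib]
  refine Finset.sum_le_sum fun u _ => Finset.sum_le_sum fun v _ => ?_
  by_cases h : u ∈ X ∪ Y ∧ v ∉ X ∪ Y ∧ G.Adj u v
  · obtain ⟨h1, h2, h3⟩ := h
    simp only [Finset.mem_union, not_or] at h1 h2
    rcases h1 with h1 | h1 <;> simp [h1, h2, h3]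
  · rw [if_neg h]
    exact Nat.zero_le _

theorem edgesBetween_compl (X : Finset V) :
    edgesBetween G (X : Set V) (Set.univ \ X) = boundaryCard G X := by
  have h1 : {e : Sym2 V | e ∈ G.edgeSet ∧ ∃ x ∈ (X : Set V), ∃ y ∈ (Set.univ \ X : Set V),
      e = s(x, y)} = (fun q : V × V => s(q.1, q.2)) ''
        (Finset.univ.filter fun q : V × V => q.1 ∈ X ∧ q.2 ∉ X ∧ G.Adj q.1 q.2) := by
    ext e
    constructor
    · rintro ⟨he, x, hx, y, hy, rfl⟩
      exact ⟨(x, y), by simpa using ⟨hx, by simpa using hy, he⟩, rfl⟩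
    · rintro ⟨⟨x, y⟩, hq, rfl⟩
      obtain ⟨hx, hy, hadj⟩ : x ∈ X ∧ y ∉ X ∧ G.Adj x y := by simpa using hq
      exact ⟨hadj, x, hx, y, by simpa using hy, rfl⟩
  rw [edgesBetween, h1, Set.InjOn.ncard_image, Set.ncard_coe_finset, boundaryCard_eq_sum,
    Finset.card_filter, Fintype.sum_prod_type]
  rintro ⟨x, y⟩ hq ⟨x', y'⟩ hq' h
  obtain ⟨hx, hy, -⟩ : x ∈ X ∧ y ∉ X ∧ G.Adj x y := by simpa using hq
  obtain ⟨hx', hy', -⟩ : x' ∈ X ∧ y' ∉ X ∧ G.Adj x' y' := by simpa using hq'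
  rcases Sym2.eq_iff.1 h with ⟨rfl, rfl⟩ | ⟨rfl, rfl⟩
  · rfl
  · exact absurd hx' hy

theorem edgeConnectivity_le_boundaryCard {X : Finset V} (hX : X.Nonempty)
    (hX' : X ≠ Finset.univ) : edgeConnectivity G ≤ boundaryCard G X := by
  rw [← edgesBetween_compl]
  refine Nat.sInf_le ⟨_, fun e he => he.1, rfl, fun hconn => ?_⟩
  obtain ⟨x, hx⟩ := hX
  obtain ⟨y, hy⟩ : ∃ y, y ∉ X := by
    by_contra! h
    exact hX' (Finset.eq_univ_iff_forall.2 h)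
  obtain ⟨p⟩ := hconn.preconnected x y
  obtain ⟨d, -, hd, hd'⟩ := p.exists_boundary_dart (X : Set V) hx hy
  have h1 := d.adj
  rw [deleteEdges_adj] at h1
  exact h1.2 ⟨h1.1, _, hd, _, ⟨trivial, hd'⟩, rfl⟩

/-- The vertex set of a connected component. -/
def componentFinset {H : SimpleGraph V} (C : H.ConnectedComponent) : Finset V :=
  open scoped Classical in Finset.univ.filter fun v => H.connectedComponentMk v = C

omit [DecidableEq V] in
theorem mem_componentFinset {H : SimpleGraph V} {C : H.ConnectedComponent} {v : V} :
    v ∈ componentFinset C ↔ H.connectedComponentMk v = C := by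
  simp [componentFinset]

omit [DecidableEq V] in
theorem componentFinset_nonempty {H : SimpleGraph V} (C : H.ConnectedComponent) :
    (componentFinset C).Nonempty := by
  induction C using ConnectedComponent.ind with | h v => exact ⟨v, mem_componentFinset.2 rfl⟩

omit [DecidableEq V] in
theorem disjoint_componentFinset {H : SimpleGraph V} {C D : H.ConnectedComponent} (h : C ≠ D) :
    Disjoint (componentFinset C) (componentFinset D) :=
  Finset.disjoint_left.2 fun _ hv hw =>
    h ((mem_componentFinset.1 hv).symm.trans (mem_componentFinset.1 hw))

theorem sum_boundaryCard_componentFinset (H : SimpleGraph V) [Fintype H.ConnectedComponent] :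
    ∑ C : H.ConnectedComponent, boundaryCard G (componentFinset C)
      = 2 * (crossing G H).edgeSet.ncard := by
  classical
  rw [← coe_edgeFinset, Set.ncard_coe_finset, ← sum_degrees_eq_twice_card_edges,
    ← Finset.sum_fiberwise Finset.univ H.connectedComponentMk]
  refine Finset.sum_congr rfl fun C _ => ?_
  rw [boundaryCard]
  refine Finset.sum_congr (by ext; simp [mem_componentFinset]) fun u hu => ?_
  rw [← card_neighborFinset_eq_degree]
  congr 1
  ext v
  rw [Finset.mem_filter_univ] at hu
  rw [mem_neighborFinset, Finset.mem_filter_univ, mem_componentFinset, ← hu, ConnectedComponent.eq,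
    H.reachable_comm]
  rfl

/-- If a graph in `𝒢₁` has no three disjoint large vertex sets with small boundaries, then many
edges join different components of any graph on the same vertices. -/
theorem card_connectedComponent_le_of_inClassG (hG : InClassG 1 G) {m : ℕ}
    (hm : 2 * m ≤ G.minDegree)
    (h3 : ∀ X : Fin 3 → Finset V, (∀ i j, i ≠ j → Disjoint (X i) (X j)) →
      (∀ i, boundaryCard G (X i) ≤ 2 * m) → ¬ ∀ i, G.minDegree + 1 ≤ (X i).card)
    (H : SimpleGraph V) :
    m * Nat.card H.ConnectedComponent ≤ (crossing G H).edgeSet.ncard + m := by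
  classical
  have key : ∀ A B C : Finset V, Disjoint A B → Disjoint A C → Disjoint B C → A.Nonempty →
      B.Nonempty → C.Nonempty → boundaryCard G A < 2 * m → boundaryCard G B < 2 * m →
      boundaryCard G C < 2 * m → False := by
    intro A B C hAB hAC hBC hA hB hC bA bB bC
    refine h3 ![A, B, C] ?_ ?_ ?_
    · intro i j hij
      fin_cases i <;> fin_cases j <;> simp_all [disjoint_comm]
    · intro i
      fin_cases i <;> simp [bA.le, bB.le, bC.le]
    · intro i
      fin_cases i
      · exact minDegree_lt_card_of_boundaryCard_lt hA (bA.trans_le hm)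
      · exact minDegree_lt_card_of_boundaryCard_lt hB (bB.trans_le hm)
      · exact minDegree_lt_card_of_boundaryCard_lt hC (bC.trans_le hm)
  by_contra! hlt
  rw [Nat.card_eq_fintype_card] at hlt
  have hsum := sum_boundaryCard_componentFinset (G := G) H
  have hp : 2 ≤ Fintype.card H.ConnectedComponent := by
    by_contra! hp
    have : m * Fintype.card H.ConnectedComponent ≤ m * 1 := Nat.mul_le_mul_left m (by omega)
    omega
  have hκ : ∀ C : H.ConnectedComponent,
      edgeConnectivity G ≤ boundaryCard G (componentFinset C) := fun C => by
    refine edgeConnectivity_le_boundaryCard (componentFinset_nonempty C) fun huniv => ?_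
    obtain ⟨D, hD⟩ := Fintype.exists_ne_of_one_lt_card (by omega) C
    obtain ⟨v, hv⟩ := componentFinset_nonempty D
    exact Finset.disjoint_left.1 (disjoint_componentFinset hD) hv (huniv ▸ Finset.mem_univ v)
  set S := Finset.univ.filter fun C : H.ConnectedComponent =>
    boundaryCard G (componentFinset C) < 2 * m with hS
  have hlow : S.card ≤ 2 := by
    by_contra! hc
    obtain ⟨A, B, C, hA, hB, hC, hAB, hAC, hBC⟩ := Finset.two_lt_card_iff.1 hc
    rw [hS, Finset.mem_filter_univ] at hA hB hC
    exact key _ _ _ (disjoint_componentFinset hAB) (disjoint_componentFinset hAC)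
      (disjoint_componentFinset hBC) (componentFinset_nonempty A) (componentFinset_nonempty B)
      (componentFinset_nonempty C) hA hB hC
  -- With `s ≤ 2` parts of boundary below `2m`, counting gives `s κ' < 2m(s - 1)`. This rules out `s
  -- = 0` and `s = 1`, and `s = 2` yields the claim.
  have hκm : edgeConnectivity G < m := by
    have h1 : S.card * edgeConnectivity G + Sᶜ.card * (2 * m)
        ≤ ∑ C : H.ConnectedComponent, boundaryCard G (componentFinset C) := by
      rw [← Finset.sum_add_sum_compl S]
      refine add_le_add (Finset.card_nsmul_le_sum _ _ _ fun C _ => hκ C)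
        (Finset.card_nsmul_le_sum _ _ _ fun C hC => ?_)
      simpa [hS] using hC
    have h2 := Finset.card_add_card_compl S
    rw [← h2] at hlt
    rw [hsum] at h1
    interval_cases S.card <;> nlinarith
  obtain ⟨W, hne, -, hdisj, ⟨r, hr⟩, hW⟩ := hG
  have hb : ∀ i, boundaryCard G (W i).toFinset = edgeConnectivity G := fun i => by
    rw [hW i, ← edgesBetween_compl, Set.coe_toFinset]
  have h01 : Disjoint (W 0).toFinset (W 1).toFinset :=
    Set.disjoint_toFinset.2 (hdisj 0 1 (by decide))
  refine key (W 0).toFinset (W 1).toFinset ((W 0).toFinset ∪ (W 1).toFinset)ᶜ h01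
    (disjoint_compl_right.mono_left Finset.subset_union_left)
    (disjoint_compl_right.mono_left Finset.subset_union_right)
    (Set.toFinset_nonempty.2 (hne 0)) (Set.toFinset_nonempty.2 (hne 1)) ⟨r, ?_⟩ ?_ ?_ ?_
  · have hr' : ∀ i, r ∉ W i := by simpa using hr
    simp [hr']
  · rw [hb]; omega
  · rw [hb]; omega
  · rw [boundaryCard_compl]
    have := boundaryCard_union_le (G := G) (W 0).toFinset (W 1).toFinset
    rw [hb, hb] at this
    omega

end Boundary

/-! ### From `k + 1` spanning trees to the property -/

section PropertyP
variable {V : Type*} [Fintype V]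

theorem hasPropertyP_of_disjoint_spanning_trees {G : SimpleGraph V} {k d : ℕ} (hd : 0 < d)
    (hV : 1 < Fintype.card V) {T : Fin (k + 1) → SimpleGraph V}
    (hT : ∀ i, T i ≤ G ∧ (T i).IsTree) (hdisj : ∀ i j, i ≠ j → Disjoint (T i) (T j)) :
    HasPropertyP k d G := by
  classical
  refine ⟨fun i => T i.castSucc, T (Fin.last k), fun i => hT _,
    fun i j hij => disjoint_edgeSet.2 (hdisj _ _ fun h => hij (Fin.castSucc_injective k h)),
    (hT _).1, (hT _).2.isAcyclic,
    fun i => disjoint_edgeSet.2 (hdisj _ _ (Fin.castSucc_lt_last i).ne'), ?_,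
    fun h => absurd (hT _).2 h⟩
  have h1 := (hT (Fin.last k)).2.card_edgeFinset
  rw [← Set.ncard_coe_finset, coe_edgeFinset] at h1
  have hV' : (1 : ℝ) < Fintype.card V := by exact_mod_cast hV
  have h2 : ((T (Fin.last k)).edgeSet.ncard : ℝ) = (Fintype.card V : ℝ) - 1 := by
    rw [← h1]; push_cast; ring
  have hd' : (0 : ℝ) < d := by exact_mod_cast hd
  rw [h2, gt_iff_lt]
  refine mul_lt_of_lt_one_left (by linarith) ?_
  rw [div_lt_one hd']
  linarith

end PropertyP

end SpectralPacking

end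

theorem corollary3p2 {V : Type*} [Fintype V] [DecidableEq V] (G : SimpleGraph V)
    [DecidableRel G.Adj] (k δ : ℕ) (hk : 2 ≤ k) (hG : SpectralPacking.InClassG 1 G)
    (hmin : G.minDegree = δ) (hδ : 2 * k + 2 ≤ δ) :
    (SpectralPacking.adjEigenvalue G 3 <
        (δ : ℝ) - 16 * ((k : ℝ) + ((δ : ℝ) - 1) / (δ : ℝ)) / (3 * ((δ : ℝ) + 1)) →
      SpectralPacking.HasPropertyP k δ G) ∧
    (SpectralPacking.signlessLapEigenvalue G 3 <
        2 * (δ : ℝ) - 16 * ((k : ℝ) + ((δ : ℝ) - 1) / (δ : ℝ)) / (3 * ((δ : ℝ) + 1)) →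
      SpectralPacking.HasPropertyP k δ G) := by
  open SpectralPacking in
  have hV : 1 < Fintype.card V := by
    obtain ⟨W, hne, -, hdisj, -, -⟩ := hG
    obtain ⟨x, hx⟩ := hne 0
    obtain ⟨y, hy⟩ := hne 1
    exact Fintype.one_lt_card_iff.2
      ⟨x, y, fun h => Set.disjoint_left.1 (hdisj 0 1 (by decide)) hx (h ▸ hy)⟩
  have : Nonempty V := Fintype.card_pos_iff.1 (by omega)
  have hP : (∀ X : Fin 3 → Finset V, (∀ i j, i ≠ j → Disjoint (X i) (X j)) →
      (∀ i, boundaryCard G (X i) ≤ 2 * (k + 1)) → ¬ ∀ i, G.minDegree + 1 ≤ (X i).card) →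
      HasPropertyP k δ G := fun h3 => by
    obtain ⟨T, hT, hdisj⟩ := exists_disjoint_spanning_trees G (k + 1)
      (card_connectedComponent_le_of_inClassG hG (by omega) h3)
    exact hasPropertyP_of_disjoint_spanning_trees (by omega) hV hT hdisj
  -- The loss `2B/s` with `B = 2(k + 1)` and `s = δ + 1`. As `(δ - 1)/δ ≥ 1/2`, it suffices that
  -- `12(k + 1) ≤ 16k + 8`.
  have hbound : 2 * ((2 * (k + 1) : ℕ) : ℝ) / ((δ + 1 : ℕ) : ℝ)
      ≤ 16 * ((k : ℝ) + ((δ : ℝ) - 1) / (δ : ℝ)) / (3 * ((δ : ℝ) + 1)) := by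
    have hδ' : (6 : ℝ) ≤ δ := by exact_mod_cast (by omega : 6 ≤ δ)
    have hk' : (2 : ℝ) ≤ k := by exact_mod_cast hk
    have h1 : 1 / 2 ≤ ((δ : ℝ) - 1) / δ := by
      rw [le_div_iff₀ (by linarith)]
      linarith
    push_cast
    rw [div_le_div_iff₀ (by linarith) (by linarith)]
    have h2 : 12 * ((k : ℝ) + 1) ≤ 16 * (k + ((δ : ℝ) - 1) / δ) := by linarith
    nlinarith [mul_le_mul_of_nonneg_right h2 (by linarith : (0 : ℝ) ≤ (δ : ℝ) + 1)]
  constructor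
  · intro h
    refine hP fun X hX hB hcard => ?_
    have := le_adjEigenvalue hX hB (Nat.succ_pos _) hcard
    rw [hmin] at this
    linarith
  · intro h
    refine hP fun X hX hB hcard => ?_
    have := le_signlessLapEigenvalue hX hB (Nat.succ_pos _) hcard
    rw [hmin] at this
    linarith
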